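/- Let $\mathbb F_q$ be the finite field with $q$ elements, let $n,d,m\ge 0$ be integers, and call a polynomial in $\mathbb F_q[X_1,\dots,X_n]$ a degree-$d$ polynomial if its total degree is at most $d$. For $T\subseteq\mathbb F_q^n$ let $$\mathrm{cl}_d(T)=\{a\in\mathbb F_q^n : f(a)=0 \text{ for every degree-}d\text{ polynomial } f \text{ vanishing on } T\}.$$ For $0\le k\le q^n$ let $\mathrm M^n_q(k)$ be the set of the first $k$ elements of $\{0,\dots,q-1\}^n$ in lexicographic order ($x\prec y$ iff $x_i<y_i$ at the smallest index $i$ with $x_i\neq y_i$), and for $S\subseteq\{0,\dots,q-1\}^n$ let $S_{\le d}=\{x\in S: x_1+\dots+x_n\le d\}$. Let $N(n,d,q-1)$ be the number of monomials $X_1^{e_1}\cdots X_n^{e_n}$ with $0\le e_1,\dots,e_n\le q-1$ and $e_1+\dots+e_n\le d$. Put $$K=\max\{k : 0\le k\le q^n,\ |\mathrm M^n_q(k)_{\le d}|\le m\}.$$ (1) For every $T\subseteq\mathbb F_q^n$ with $|T|=m$ we have $|\mathrm{cl}_d(T)|\le K$. Moreover $$K=\begin{cases}\max\{k: 0\le k\le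 q^n,\ |\mathrm M^n_q(k)_{\le d}|=m\} & \text{if } m\le N(n,d,q-1),\\ q^n & \text{if } m>N(n,d,q-1).\end{cases}$$ (2) Suppose $0\le m\le q^n$. Then some $T\subseteq\mathbb F_q^n$ with $|T|=m$ satisfies $|\mathrm{cl}_d(T)|=K$. Explicitly: for each $i\in\{1,\dots,n\}$ let $a_{i,1},\dots,a_{i,q}$ be any enumeration of $\mathbb F_q$ without repetition, and let $$T_0=\{(a_{1,e_1+1},\dots,a_{n,e_n+1}) : (e_1,\dots,e_n)\in \mathrm M^n_q(K)_{\le d}\}.$$ If $|T_0|\ge m$, let $T=T_0$; otherwise let $T$ be any set obtained from $T_0$ by adding $m-|T_0|$ elements of $\mathbb F_q^n\setminus T_0$. Then $|T|=m$ and $|\mathrm{cl}_d(T)|=K$. -/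

import Mathlib

/-- The degree-`d` closure of `T ⊆ F^n`: the points at which every polynomial of total degree
at most `d` that vanishes on `T` also vanishes. -/
def degreeClosure {F : Type*} [Field F] {n : ℕ} (d : ℕ) (T : Set (Fin n → F)) :
    Set (Fin n → F) :=
  {a | ∀ f : MvPolynomial (Fin n) F, f.totalDegree ≤ d →
    (∀ t ∈ T, MvPolynomial.eval t f = 0) → MvPolynomial.eval a f = 0}

open Classical in
/-- The first `k` elements of `{0, …, q-1}^n` in lexicographic order (first coordinate most
significant): the vectors that have fewer than `k` vectors strictly before them. -/
noncomputable def lexInitial (n q k : ℕ) : Finset (Fin n → Fin q) :=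
  Finset.univ.filter fun x =>
    (Finset.univ.filter fun y : Fin n → Fin q => toLex y < toLex x).card < k

/-- The elements of `S ⊆ {0, …, q-1}^n` of generalized Hamming weight `∑ i, x i` at most `d`. -/
def lowWeight {n q : ℕ} (d : ℕ) (S : Finset (Fin n → Fin q)) : Finset (Fin n → Fin q) :=
  S.filter fun x => ∑ i, (x i : ℕ) ≤ d

/-- `N(n,d,δ)`: the number of monomials in `n` variables (given by their exponent vectors) with
all individual degrees at most `δ` and total degree at most `d`. -/
def numMonomials (n d δ : ℕ) : ℕ :=
  ((Fintype.piFinset fun _ : Fin n => Finset.range (δ + 1)).filter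
    fun e => ∑ i, e i ≤ d).card

/-- Given an enumeration `a i 0, …, a i (q-1)` of `F` for every coordinate `i`, the bijection
`{0, …, q-1}^n → F^n`, `e ↦ (a 0 (e 0), …, a (n-1) (e (n-1)))`. -/
def gridPoint {F : Type*} {n q : ℕ} (a : Fin n → (Fin q ≃ F)) : (Fin n → Fin q) ≃ (Fin n → F) :=
  Equiv.piCongrRight a

/-! Upper bound. Let `S` be the closure of `T`, and call a monomial standard if, as a function on
`S`, it is not a combination of smaller ones. The standard exponents form a down-set `D` of size
`|S|` (`exists_standard`). A combination of standard monomials of degree at most `d` that vanishes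
on `T` vanishes on `S`, hence is zero; so these monomials are independent on `T` and there are at
most `|T|` of them. It remains to see that a lexicographic initial segment has the fewest points of
weight at most `d` among down-sets of its size (`card_lowWeight_lexInitial_le`).

That is proved by induction on `n`. Pass to a down-set that is colexicographically least among those
that do at least as well. Sections are initial segments by induction. If the whole set is not one,
its first gap `x` weighs less than its last element `y`, and the two differ in every coordinate.
Chaining through points that share a coordinate with both then contradicts this, except in the
plane, where reflections in diagonals are needed.

Sharpness. On the grid copy of a down-set, a polynomial of degree at most `d` vanishing at the
points of weight at most `d` vanishes everywhere (`eval_gridPoint_eq_zero`), by the combinatorial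
Nullstellensatz on boxes. Applied to the first `K` vectors this gives a closure of at least `K`
points. -/

/-! ### Lexicographic rank and initial segments -/

section LexInitial

variable {n q : ℕ}

open Classical in
/-- The number of vectors strictly before `x` in lexicographic order. -/
noncomputable def lexRank (x : Fin n → Fin q) : ℕ :=
  (Finset.univ.filter fun y : Fin n → Fin q => toLex y < toLex x).card

theorem mem_lexInitial {k : ℕ} {x : Fin n → Fin q} : x ∈ lexInitial n q k ↔ lexRank x < k := by
  classical
  simp only [lexInitial, lexRank, Finset.mem_filter, Finset.mem_univ, true_and]

theorem lexRank_lt_lexRank {x y : Fin n → Fin q} (h : toLex x < toLex y) :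
    lexRank x < lexRank y := by
  refine Finset.card_lt_card ⟨fun z hz => ?_, fun hs => ?_⟩
  · simp only [Finset.mem_filter, Finset.mem_univ, true_and] at hz ⊢
    exact hz.trans h
  · have := hs (show x ∈ _ by simpa using h)
    exact lt_irrefl _ (by simpa using this : toLex x < toLex x)

theorem lexRank_injective : Function.Injective (lexRank : (Fin n → Fin q) → ℕ) := by
  intro x y h
  rcases lt_trichotomy (toLex x) (toLex y) with h1 | h1 | h1
  · exact absurd h (lexRank_lt_lexRank h1).ne
  · exact toLex.injective h1
  · exact absurd h (lexRank_lt_lexRank h1).ne'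

theorem lexRank_lt (x : Fin n → Fin q) : lexRank x < q ^ n := by
  have : lexRank x < (Finset.univ : Finset (Fin n → Fin q)).card := by
    refine Finset.card_lt_card ⟨Finset.subset_univ _, fun hs => ?_⟩
    have := hs (Finset.mem_univ x)
    exact lt_irrefl _ (by simpa using this : toLex x < toLex x)
  simpa using this

theorem image_lexRank_univ :
    (Finset.univ : Finset (Fin n → Fin q)).image lexRank = Finset.range (q ^ n) := by
  refine Finset.eq_of_subset_of_card_le (fun k hk => ?_) ?_
  · obtain ⟨x, -, rfl⟩ := Finset.mem_image.1 hk
    exact Finset.mem_range.2 (lexRank_lt x)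
  · rw [Finset.card_image_of_injective _ lexRank_injective]
    simp

theorem image_lexRank_lexInitial {k : ℕ} (hk : k ≤ q ^ n) :
    (lexInitial n q k).image lexRank = Finset.range k := by
  ext j
  simp only [Finset.mem_image, mem_lexInitial, Finset.mem_range]
  constructor
  · rintro ⟨x, hx, rfl⟩
    exact hx
  · intro hj
    have : j ∈ (Finset.univ : Finset (Fin n → Fin q)).image lexRank := by
      rw [image_lexRank_univ]
      exact Finset.mem_range.2 (hj.trans_le hk)
    obtain ⟨x, -, rfl⟩ := Finset.mem_image.1 this
    exact ⟨x, hj, rfl⟩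

theorem card_lexInitial {k : ℕ} (hk : k ≤ q ^ n) : (lexInitial n q k).card = k := by
  rw [← Finset.card_image_of_injective _ lexRank_injective, image_lexRank_lexInitial hk,
    Finset.card_range]

theorem lexInitial_mono {k l : ℕ} (h : k ≤ l) : lexInitial n q k ⊆ lexInitial n q l := by
  intro x hx
  rw [mem_lexInitial] at hx ⊢
  omega

theorem lexInitial_pow : lexInitial n q (q ^ n) = Finset.univ := by
  ext x
  simp [mem_lexInitial, lexRank_lt]

theorem mem_lexInitial_of_toLex_le {k : ℕ} {x y : Fin n → Fin q} (hy : y ∈ lexInitial n q k)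
    (h : toLex x ≤ toLex y) : x ∈ lexInitial n q k := by
  rw [mem_lexInitial] at hy ⊢
  rcases h.eq_or_lt with h | h
  · rwa [toLex.injective h]
  · exact (lexRank_lt_lexRank h).trans hy

theorem isLowerSet_lexInitial (k : ℕ) :
    IsLowerSet (lexInitial n q k : Set (Fin n → Fin q)) := fun _ _ hle hy =>
  mem_lexInitial_of_toLex_le (Finset.mem_coe.1 hy) (Pi.toLex_monotone hle)

theorem eq_lexInitial_card {D : Finset (Fin n → Fin q)}
    (hD : ∀ x y, y ∈ D → toLex x < toLex y → x ∈ D) : D = lexInitial n q D.card := by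
  ext x
  rw [mem_lexInitial]
  constructor
  · intro hx
    refine Finset.card_lt_card ⟨fun z hz => hD z x hx (by simpa using hz), fun hs => ?_⟩
    have := hs hx
    exact lt_irrefl _ (by simpa using this : toLex x < toLex x)
  · intro hx
    by_contra hxD
    refine hx.not_ge (Finset.card_le_card fun z hz => ?_)
    simp only [Finset.mem_filter, Finset.mem_univ, true_and]
    rcases lt_trichotomy (toLex z) (toLex x) with h | h | h
    · exact h
    · exact absurd (toLex.injective h ▸ hz) hxD
    · exact absurd (hD x z hz h) hxD

theorem mem_lowWeight {d : ℕ} {S : Finset (Fin n → Fin q)} {x : Fin n → Fin q} :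
    x ∈ lowWeight d S ↔ x ∈ S ∧ ∑ i, (x i : ℕ) ≤ d := by
  simp [lowWeight]

theorem lowWeight_subset (d : ℕ) (S : Finset (Fin n → Fin q)) : lowWeight d S ⊆ S :=
  Finset.filter_subset _ _

theorem lowWeight_mono (d : ℕ) {S T : Finset (Fin n → Fin q)} (h : S ⊆ T) :
    lowWeight d S ⊆ lowWeight d T :=
  Finset.filter_subset_filter _ h

/-- Only the vector of rank `k` is new. Since the count climbs by steps of at most one, it cannot
jump over `m`. -/
theorem card_lowWeight_lexInitial_succ_le (d k : ℕ) :
    (lowWeight d (lexInitial n q (k + 1))).card ≤ (lowWeight d (lexInitial n q k)).card + 1 := by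
  have hsub : lowWeight d (lexInitial n q (k + 1)) ⊆
      lowWeight d (lexInitial n q k) ∪ Finset.univ.filter fun x => lexRank x = k := by
    intro x hx
    simp only [mem_lowWeight, mem_lexInitial, Finset.mem_union, Finset.mem_filter,
      Finset.mem_univ, true_and] at hx ⊢
    omega
  refine (Finset.card_le_card hsub).trans ((Finset.card_union_le _ _).trans ?_)
  gcongr
  rw [Finset.card_le_one]
  intro x hx y hy
  simp only [Finset.mem_filter, Finset.mem_univ, true_and] at hx hy
  exact lexRank_injective (hx.trans hy.symm)

theorem card_lowWeight_univ (n d : ℕ) {q : ℕ} (hq : 0 < q) :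
    (lowWeight d (Finset.univ : Finset (Fin n → Fin q))).card = numMonomials n d (q - 1) := by
  refine Finset.card_bij (fun x _ i => (x i : ℕ)) ?_ ?_ ?_
  · intro x hx
    rw [mem_lowWeight] at hx
    simp only [Finset.mem_filter, Fintype.mem_piFinset, Finset.mem_range]
    exact ⟨fun i => by have := (x i).2; omega, hx.2⟩
  · intro x _ y _ h
    funext i
    exact Fin.ext (congrFun h i)
  · intro e he
    simp only [Finset.mem_filter, Fintype.mem_piFinset, Finset.mem_range] at he
    exact ⟨fun i => ⟨e i, by have := he.1 i; omega⟩, by simpa [mem_lowWeight] using he.2, rfl⟩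

end LexInitial

/-! ### Colexicographically minimal down-sets -/

section ColexMinimal

variable {n q : ℕ}

/-- `D` is a down-set that cannot be replaced by a colexicographically smaller down-set of the
same size without increasing the number of elements of weight at most `d`. -/
def IsColexMinimal (d : ℕ) (D : Finset (Fin n → Fin q)) : Prop :=
  IsLowerSet (D : Set (Fin n → Fin q)) ∧
    ∀ E : Finset (Fin n → Fin q), IsLowerSet (E : Set (Fin n → Fin q)) → E.card = D.card →
      (lowWeight d E).card ≤ (lowWeight d D).card →
      (∀ a ∈ E, a ∉ D → ∃ b ∈ D, b ∉ E ∧ toLex a < toLex b) → E = D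

theorem exists_isColexMinimal (d : ℕ) (D : Finset (Fin n → Fin q))
    (hD : IsLowerSet (D : Set (Fin n → Fin q))) :
    ∃ D' : Finset (Fin n → Fin q), IsColexMinimal d D' ∧ D'.card = D.card ∧
      (lowWeight d D').card ≤ (lowWeight d D).card := by
  classical
  obtain ⟨D', hD', hmin⟩ := Finset.exists_min_image
    (Finset.univ.filter fun E : Finset (Fin n → Fin q) => IsLowerSet (E : Set (Fin n → Fin q)) ∧
      E.card = D.card ∧ (lowWeight d E).card ≤ (lowWeight d D).card)
    (fun E => toColex (E.map (toLex (α := Fin n → Fin q)).toEmbedding))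
    ⟨D, by simp [hD]⟩
  simp only [Finset.mem_filter, Finset.mem_univ, true_and] at hD' hmin
  refine ⟨D', ⟨hD'.1, fun E hE hc hl hlt => ?_⟩, hD'.2⟩
  have h1 := hmin E ⟨hE, hc.trans hD'.2.1, hl.trans hD'.2.2⟩
  have h2 : toColex (E.map (toLex (α := Fin n → Fin q)).toEmbedding) ≤
      toColex (D'.map (toLex (α := Fin n → Fin q)).toEmbedding) := by
    rw [Finset.Colex.toColex_le_toColex]
    intro a ha haD
    obtain ⟨a, haE, rfl⟩ := Finset.mem_map.1 ha
    obtain ⟨b, hb, hbE, hab⟩ := hlt a haE fun h => haD (Finset.mem_map_of_mem _ h)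
    refine ⟨toLex b, Finset.mem_map_of_mem _ hb, fun h => hbE ?_, hab.le⟩
    simpa using h
  exact Finset.map_injective _ (toColex.injective (h2.antisymm h1))

/-- A weight-nondecreasing injective replacement of elements by lexicographically smaller ones
that keeps a colex-minimal down-set a down-set is trivial. -/
theorem IsColexMinimal.map_eq_self {d : ℕ} {D : Finset (Fin n → Fin q)} (hD : IsColexMinimal d D)
    (φ : (Fin n → Fin q) → Fin n → Fin q) (hinj : Set.InjOn φ D)
    (hlt : ∀ z ∈ D, φ z ≠ z → toLex (φ z) < toLex z)
    (hw : ∀ z ∈ D, ∑ i, (z i : ℕ) ≤ ∑ i, (φ z i : ℕ))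
    (hnew : ∀ z ∈ D, ∀ z' ∈ D, φ z ≠ z → φ z' ≠ z)
    (hlow : IsLowerSet {a | ∃ z ∈ D, φ z = a}) : ∀ z ∈ D, φ z = z := by
  classical
  have hE : D.image φ = D := by
    refine hD.2 _ ?_ (Finset.card_image_of_injOn hinj) ?_ ?_
    · intro a b hab ha
      simp only [Finset.coe_image, Set.mem_image, Finset.mem_coe] at ha ⊢
      exact hlow hab ha
    · have hsub : lowWeight d (D.image φ) ⊆ (lowWeight d D).image φ := by
        intro a ha
        rw [mem_lowWeight, Finset.mem_image] at ha
        obtain ⟨⟨z, hz, rfl⟩, hd⟩ := ha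
        exact Finset.mem_image_of_mem _ (mem_lowWeight.2 ⟨hz, (hw z hz).trans hd⟩)
      exact (Finset.card_le_card hsub).trans Finset.card_image_le
    · intro a ha haD
      obtain ⟨z, hz, rfl⟩ := Finset.mem_image.1 ha
      have hne : φ z ≠ z := fun h => haD (by rwa [h])
      -- The vacated place `z` is the larger lost element; `hnew` says that nothing refills it.
      refine ⟨z, hz, fun h => ?_, hlt z hz hne⟩
      obtain ⟨z', hz', h⟩ := Finset.mem_image.1 h
      exact hnew z hz z' hz' hne h
  intro z hz
  by_contra hne
  have h := hz
  rw [← hE] at h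
  obtain ⟨z', hz', h⟩ := Finset.mem_image.1 h
  exact hnew z hz z' hz' hne h

/-- Otherwise exchange `y` for `x`. Removing the last element and filling the first gap keeps a
down-set, and the exchange does not lower the weight, so minimality is violated. -/
theorem IsColexMinimal.weight_lt {d : ℕ} {D : Finset (Fin n → Fin q)} (hD : IsColexMinimal d D)
    {x y : Fin n → Fin q} (hx : x ∉ D) (hy : y ∈ D) (hxy : toLex x < toLex y)
    (hmin : ∀ z, toLex z < toLex x → z ∈ D) (hmax : ∀ z ∈ D, toLex z ≤ toLex y) :
    ∑ i, (x i : ℕ) < ∑ i, (y i : ℕ) := by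
  classical
  by_contra hw
  rw [not_lt] at hw
  have hne : x ≠ y := fun h => hx (h ▸ hy)
  have key := hD.map_eq_self (fun z => if z = y then x else z) ?_ ?_ ?_ ?_ ?_ y hy
  · exact hne (by simpa using key)
  · intro z hz z' hz' h
    have hz : z ∈ D := hz
    have hz' : z' ∈ D := hz'
    grind
  · intro z hz h
    grind
  · intro z hz
    split_ifs with h
    · rwa [h]
    · exact le_rfl
  · intro z hz z' hz' h
    grind
  · rintro b a hab ⟨z, hz, rfl⟩
    by_cases hzy : z = y
    · simp only [hzy, if_true] at hab
      rcases (Pi.toLex_monotone hab).eq_or_lt with h | h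
      · exact ⟨y, hy, by simpa using (toLex.injective h).symm⟩
      · refine ⟨a, hmin a h, if_neg ?_⟩
        rintro rfl
        exact lt_asymm h hxy
    · simp only [hzy, if_false] at hab
      refine ⟨a, hD.1 hab hz, if_neg ?_⟩
      rintro rfl
      exact hzy (toLex.injective ((hmax z hz).antisymm (Pi.toLex_monotone hab)))

/-- A colex-minimal down-set that is not an initial segment has a first gap and a last element,
and the gap has smaller weight. -/
theorem IsColexMinimal.exists_gap {d : ℕ} {D : Finset (Fin n → Fin q)} (hD : IsColexMinimal d D)
    (hne : ¬ ∀ x y, y ∈ D → toLex x < toLex y → x ∈ D) :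
    ∃ x y, x ∉ D ∧ y ∈ D ∧ toLex x < toLex y ∧ ∑ i, (x i : ℕ) < ∑ i, (y i : ℕ) := by
  classical
  push Not at hne
  obtain ⟨x₀, y₀, hy₀, hxy₀, hx₀⟩ := hne
  obtain ⟨x, hx, hxmin⟩ := Finset.exists_min_image Dᶜ (fun z => toLex z) ⟨x₀, by simpa using hx₀⟩
  obtain ⟨y, hy, hymax⟩ := Finset.exists_max_image D (fun z => toLex z) ⟨y₀, hy₀⟩
  rw [Finset.mem_compl] at hx
  have hxy : toLex x < toLex y :=
    ((hxmin x₀ (by simpa using hx₀)).trans_lt hxy₀).trans_le (hymax y₀ hy₀)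
  refine ⟨x, y, hx, hy, hxy, hD.weight_lt hx hy hxy (fun z hz => ?_) hymax⟩
  by_contra h
  exact (hxmin z (by simpa using h)).not_gt hz

end ColexMinimal

/-! ### Sections and compression in one coordinate -/

section Slices

variable {n q : ℕ}

theorem toLex_removeNth_lt {x y : Fin (n + 1) → Fin q} {i : Fin (n + 1)} (hi : x i = y i)
    (h : toLex x < toLex y) : toLex (i.removeNth x) < toLex (i.removeNth y) := by
  obtain ⟨j, hj, hlt⟩ := h
  have hji : j ≠ i := by
    rintro rfl
    exact hlt.ne hi
  obtain ⟨k, rfl⟩ := Fin.exists_succAbove_eq hji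
  exact ⟨k, fun l hl => hj _ (Fin.strictMono_succAbove i hl), hlt⟩

theorem toLex_lt_of_removeNth_lt {x y : Fin (n + 1) → Fin q} {i : Fin (n + 1)} (hi : x i = y i)
    (h : toLex (i.removeNth x) < toLex (i.removeNth y)) : toLex x < toLex y := by
  rcases lt_trichotomy (toLex x) (toLex y) with h' | h' | h'
  · exact h'
  · rw [toLex.injective h'] at h
    exact absurd h (lt_irrefl _)
  · exact absurd h (toLex_removeNth_lt hi.symm h').not_gt

/-- The section of `D` at `x i = c`. -/
def slice (D : Finset (Fin (n + 1) → Fin q)) (i : Fin (n + 1)) (c : Fin q) :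
    Finset (Fin n → Fin q) :=
  Finset.univ.filter fun p => (i.insertNth c p : Fin (n + 1) → Fin q) ∈ D

theorem mem_slice {D : Finset (Fin (n + 1) → Fin q)} {i : Fin (n + 1)} {c : Fin q}
    {p : Fin n → Fin q} : p ∈ slice D i c ↔ (i.insertNth c p : Fin (n + 1) → Fin q) ∈ D := by
  simp [slice]

theorem removeNth_mem_slice {D : Finset (Fin (n + 1) → Fin q)} {i : Fin (n + 1)}
    {x : Fin (n + 1) → Fin q} : i.removeNth x ∈ slice D i (x i) ↔ x ∈ D := by
  rw [mem_slice, Fin.insertNth_self_removeNth]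

theorem card_eq_sum_slice (D : Finset (Fin (n + 1) → Fin q)) (i : Fin (n + 1)) :
    D.card = ∑ c, (slice D i c).card := by
  rw [Finset.card_eq_sum_card_fiberwise (f := fun x => x i) (t := Finset.univ) (by simp)]
  refine Finset.sum_congr rfl fun c _ => ?_
  refine Finset.card_bij' (fun x _ => i.removeNth x) (fun p _ => i.insertNth c p) ?_ ?_ ?_ ?_
  · intro x hx
    obtain ⟨hxD, rfl⟩ := Finset.mem_filter.1 hx
    exact removeNth_mem_slice.2 hxD
  · intro p hp
    simpa using mem_slice.1 hp
  · intro x hx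
    obtain ⟨hx, rfl⟩ := Finset.mem_filter.1 hx
    simp
  · intro p hp
    simp

theorem slice_lowWeight (d : ℕ) (D : Finset (Fin (n + 1) → Fin q)) (i : Fin (n + 1)) (c : Fin q) :
    slice (lowWeight d D) i c = if (c : ℕ) ≤ d then lowWeight (d - c) (slice D i c) else ∅ := by
  ext p
  have hsum : ∑ j, ((i.insertNth c p : Fin (n + 1) → Fin q) j : ℕ) = c + ∑ j, (p j : ℕ) := by
    rw [Fin.sum_univ_succAbove _ i]
    simp
  split_ifs with h
  · rw [mem_slice, mem_lowWeight, mem_lowWeight, mem_slice, hsum]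
    have : (c : ℕ) + ∑ j, (p j : ℕ) ≤ d ↔ ∑ j, (p j : ℕ) ≤ d - c := by omega
    rw [this]
  · rw [mem_slice, mem_lowWeight, hsum]
    have : ¬ ((c : ℕ) + ∑ j, (p j : ℕ) ≤ d) := by omega
    simp [this]

/-- Replace every section at coordinate `i` by the initial segment of the same size. -/
noncomputable def compress (D : Finset (Fin (n + 1) → Fin q)) (i : Fin (n + 1)) :
    Finset (Fin (n + 1) → Fin q) :=
  open Classical in
  Finset.univ.filter fun x => i.removeNth x ∈ lexInitial n q (slice D i (x i)).card

theorem mem_compress {D : Finset (Fin (n + 1) → Fin q)} {i : Fin (n + 1)}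
    {x : Fin (n + 1) → Fin q} :
    x ∈ compress D i ↔ i.removeNth x ∈ lexInitial n q (slice D i (x i)).card := by
  simp [compress]

theorem slice_compress (D : Finset (Fin (n + 1) → Fin q)) (i : Fin (n + 1)) (c : Fin q) :
    slice (compress D i) i c = lexInitial n q (slice D i c).card := by
  ext p
  rw [mem_slice, mem_compress]
  simp

theorem card_slice_le (D : Finset (Fin (n + 1) → Fin q)) (i : Fin (n + 1)) (c : Fin q) :
    (slice D i c).card ≤ q ^ n := by
  simpa using Finset.card_le_univ (slice D i c)

theorem card_compress (D : Finset (Fin (n + 1) → Fin q)) (i : Fin (n + 1)) :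
    (compress D i).card = D.card := by
  rw [card_eq_sum_slice _ i, card_eq_sum_slice D i]
  refine Finset.sum_congr rfl fun c _ => ?_
  rw [slice_compress, card_lexInitial (card_slice_le D i c)]

theorem slice_anti {D : Finset (Fin (n + 1) → Fin q)}
    (hD : IsLowerSet (D : Set (Fin (n + 1) → Fin q))) (i : Fin (n + 1)) {c c' : Fin q}
    (h : c ≤ c') : slice D i c' ⊆ slice D i c := by
  intro p hp
  rw [mem_slice] at hp ⊢
  refine hD ?_ hp
  rw [Fin.insertNth_le_iff]
  simpa using h

theorem isLowerSet_slice {D : Finset (Fin (n + 1) → Fin q)}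
    (hD : IsLowerSet (D : Set (Fin (n + 1) → Fin q))) (i : Fin (n + 1)) (c : Fin q) :
    IsLowerSet (slice D i c : Set (Fin n → Fin q)) := by
  intro p p' h hp
  rw [Finset.mem_coe, mem_slice] at hp ⊢
  refine hD ?_ hp
  rw [Fin.insertNth_le_iff]
  refine ⟨by simp, fun j => ?_⟩
  simpa using h j

theorem isLowerSet_compress {D : Finset (Fin (n + 1) → Fin q)}
    (hD : IsLowerSet (D : Set (Fin (n + 1) → Fin q))) (i : Fin (n + 1)) :
    IsLowerSet (compress D i : Set (Fin (n + 1) → Fin q)) := by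
  intro x y h hx
  rw [Finset.mem_coe, mem_compress] at hx ⊢
  refine lexInitial_mono (Finset.card_le_card (slice_anti hD i (h i))) ?_
  exact mem_lexInitial_of_toLex_le hx (Pi.toLex_monotone fun j => h _)

/-- Summed over sections: at height `c` the weight bound becomes `d - c`, so the induction
hypothesis is needed for all `d`. -/
theorem card_lowWeight_compress_le {d : ℕ} {D : Finset (Fin (n + 1) → Fin q)}
    (hD : IsLowerSet (D : Set (Fin (n + 1) → Fin q))) (i : Fin (n + 1))
    (ih : ∀ (d : ℕ) (D : Finset (Fin n → Fin q)), IsLowerSet (D : Set (Fin n → Fin q)) →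
      (lowWeight d (lexInitial n q D.card)).card ≤ (lowWeight d D).card) :
    (lowWeight d (compress D i)).card ≤ (lowWeight d D).card := by
  rw [card_eq_sum_slice _ i, card_eq_sum_slice (lowWeight d D) i]
  refine Finset.sum_le_sum fun c _ => ?_
  rw [slice_lowWeight, slice_lowWeight, slice_compress]
  split_ifs
  · exact ih _ _ (isLowerSet_slice hD i c)
  · exact le_rfl

/-- Within a section, every point gained by compression precedes some point lost, so compression can
only go down in the colexicographic order. -/
theorem IsColexMinimal.compress_eq {d : ℕ} {D : Finset (Fin (n + 1) → Fin q)}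
    (hD : IsColexMinimal d D) (i : Fin (n + 1))
    (ih : ∀ (d : ℕ) (D : Finset (Fin n → Fin q)), IsLowerSet (D : Set (Fin n → Fin q)) →
      (lowWeight d (lexInitial n q D.card)).card ≤ (lowWeight d D).card) :
    compress D i = D := by
  refine hD.2 _ (isLowerSet_compress hD.1 i) (card_compress D i)
    (card_lowWeight_compress_le hD.1 i ih) fun a ha haD => ?_
  have ha' := mem_compress.1 ha
  have hnot : ¬ slice D i (a i) ⊆ lexInitial n q (slice D i (a i)).card := by
    intro hsub
    have heq := Finset.eq_of_subset_of_card_le hsub (card_lexInitial (card_slice_le D i _)).le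
    rw [← heq] at ha'
    exact haD (removeNth_mem_slice.1 ha')
  obtain ⟨p, hp, hpn⟩ := Finset.not_subset.1 hnot
  refine ⟨i.insertNth (a i) p, mem_slice.1 hp, ?_, ?_⟩
  · rw [mem_compress]
    simpa using hpn
  · refine toLex_lt_of_removeNth_lt (i := i) (by simp) ?_
    rw [Fin.removeNth_insertNth]
    by_contra h
    exact hpn (mem_lexInitial_of_toLex_le ha' (not_lt.1 h))

/-- All sections of a colex-minimal down-set are initial segments. -/
theorem IsColexMinimal.mem_of_apply_eq {d : ℕ} {D : Finset (Fin (n + 1) → Fin q)}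
    (hD : IsColexMinimal d D)
    (ih : ∀ (d : ℕ) (D : Finset (Fin n → Fin q)), IsLowerSet (D : Set (Fin n → Fin q)) →
      (lowWeight d (lexInitial n q D.card)).card ≤ (lowWeight d D).card)
    {x y : Fin (n + 1) → Fin q} (hy : y ∈ D) (hxy : toLex x < toLex y) (i : Fin (n + 1))
    (hi : x i = y i) : x ∈ D := by
  rw [← hD.compress_eq i ih, mem_compress] at hy ⊢
  rw [hi]
  exact mem_lexInitial_of_toLex_le hy (toLex_removeNth_lt hi hxy).le

end Slices

/-! ### The plane: reflections in diagonals -/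

section TwoDim

variable {q : ℕ}

/-- `D` is stable under moving points above the diagonal by the reflection
`(i, j) ↦ (j - c, i + c)`. -/
def ReflectStable (D : Finset (Fin 2 → Fin q)) (c : ℤ) : Prop :=
  ∀ z ∈ D, (z 1 : ℤ) < z 0 + c → 0 ≤ (z 1 : ℤ) - c → 0 ≤ (z 0 : ℤ) + c → (z 0 : ℤ) + c < q →
    ∃ u ∈ D, (u 0 : ℤ) = z 1 - c ∧ (u 1 : ℤ) = z 0 + c

theorem exists_finTwo {q : ℕ} {i j : ℤ} (hi : 0 ≤ i) (hi' : i < q) (hj : 0 ≤ j) (hj' : j < q) :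
    ∃ z : Fin 2 → Fin q, (z 0 : ℤ) = i ∧ (z 1 : ℤ) = j := by
  lift i to ℕ using hi
  lift j to ℕ using hj
  exact ⟨![⟨i, by omega⟩, ⟨j, by omega⟩], by simp, by simp⟩

theorem finTwo_ext {x y : Fin 2 → Fin q} (h0 : (x 0 : ℤ) = y 0) (h1 : (x 1 : ℤ) = y 1) :
    x = y := by
  funext i
  fin_cases i
  · exact Fin.ext (by exact_mod_cast h0)
  · exact Fin.ext (by exact_mod_cast h1)

theorem mem_of_le_finTwo {D : Finset (Fin 2 → Fin q)}
    (hD : IsLowerSet (D : Set (Fin 2 → Fin q))) {x y : Fin 2 → Fin q} (hy : y ∈ D)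
    (h0 : (x 0 : ℤ) ≤ y 0) (h1 : (x 1 : ℤ) ≤ y 1) : x ∈ D := by
  refine hD (a := y) (fun i => ?_) hy
  fin_cases i
  · exact Fin.le_def.2 (by exact_mod_cast h0)
  · exact Fin.le_def.2 (by exact_mod_cast h1)

/-- Reflection in the line `j = i + c` keeps the weight and lowers the first coordinate of points
with `j < i + c`. Move all such points whose reflection is missing at once; if the image is a
down-set, minimality says that none moved. The image could fail to be a down-set only where the
reflection leaves the grid, and there stability for the neighbouring line closer to `c = 0` helps.
-/
theorem IsColexMinimal.reflectStable_step {d : ℕ} {D : Finset (Fin 2 → Fin q)}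
    (hD : IsColexMinimal d D) {c : ℤ} (hneg : c < 0 → ReflectStable D (c + 1))
    (hpos : 0 < c → ReflectStable D (c - 1)) : ReflectStable D c := by
  classical
  have hb : ∀ (z : Fin 2 → Fin q) (i : Fin 2), 0 ≤ (z i : ℤ) ∧ (z i : ℤ) < q := fun z i =>
    ⟨by omega, by have := (z i).2; omega⟩
  have low : ∀ {x y : Fin 2 → Fin q}, y ∈ D → (x 0 : ℤ) ≤ y 0 → (x 1 : ℤ) ≤ y 1 → x ∈ D :=
    fun hy h0 h1 => mem_of_le_finTwo hD.1 hy h0 h1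
  -- the points that are moved
  let A : (Fin 2 → Fin q) → Prop := fun z => (z 1 : ℤ) < z 0 + c ∧ 0 ≤ (z 1 : ℤ) - c ∧
    0 ≤ (z 0 : ℤ) + c ∧ (z 0 : ℤ) + c < q ∧
    ¬ ∃ u ∈ D, (u 0 : ℤ) = z 1 - c ∧ (u 1 : ℤ) = z 0 + c
  have hr : ∀ z, ∃ u : Fin 2 → Fin q, A z → (u 0 : ℤ) = z 1 - c ∧ (u 1 : ℤ) = z 0 + c := by
    intro z
    by_cases hz : A z
    · obtain ⟨h1, h2, h3, h4, -⟩ := hz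
      have := hb z 0
      obtain ⟨u, hu⟩ := exists_finTwo (q := q) h2 (by omega) h3 h4
      exact ⟨u, fun _ => hu⟩
    · exact ⟨z, fun h => absurd h hz⟩
  choose r hr using hr
  have hrD : ∀ z, A z → r z ∉ D := fun z hz h => hz.2.2.2.2 ⟨r z, h, hr z hz⟩
  have hrne : ∀ z, A z → r z ≠ z := by
    intro z hz h
    have h1 := (hr z hz).1
    rw [h] at h1
    have := hz.1
    omega
  let φ : (Fin 2 → Fin q) → Fin 2 → Fin q := fun z => if A z then r z else z
  have φA : ∀ z, A z → φ z = r z := fun z hz => if_pos hz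
  have φnA : ∀ z, ¬ A z → φ z = z := fun z hz => if_neg hz
  have hAof : ∀ z, φ z ≠ z → A z := fun z h => by
    by_contra h'
    exact h (φnA z h')
  have key := hD.map_eq_self φ ?_ ?_ ?_ ?_ ?_
  · intro z hz h1 h2 h3 h4
    by_contra hno
    have hA : A z := ⟨h1, h2, h3, h4, hno⟩
    exact hrne z hA (by rw [← φA z hA]; exact key z hz)
  · intro z hz z' hz' h
    have hz : z ∈ D := hz
    have hz' : z' ∈ D := hz'
    by_cases hA : A z <;> by_cases hA' : A z'
    · rw [φA z hA, φA z' hA'] at h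
      have h1 := hr z hA
      have h2 := hr z' hA'
      rw [h] at h1
      exact finTwo_ext (by omega) (by omega)
    · rw [φA z hA, φnA z' hA'] at h
      exact absurd (h ▸ hz') (hrD z hA)
    · rw [φnA z hA, φA z' hA'] at h
      exact absurd (h ▸ hz) (hrD z' hA')
    · rwa [φnA z hA, φnA z' hA'] at h
  · intro z hz hne
    have hA := hAof z hne
    rw [φA z hA]
    refine ⟨0, fun j hj => absurd hj (by simp), ?_⟩
    have h1 := (hr z hA).1
    have h2 := hA.1
    change r z 0 < z 0
    rw [Fin.lt_def]
    omega
  · intro z hz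
    by_cases hA : A z
    · rw [φA z hA, Fin.sum_univ_two, Fin.sum_univ_two]
      have := hr z hA
      omega
    · rw [φnA z hA]
  · intro z hz z' hz' hne h
    have hA := hAof z hne
    by_cases hA' : A z'
    · rw [φA z' hA'] at h
      exact hrD z' hA' (h ▸ hz)
    · rw [φnA z' hA'] at h
      exact hA' (h ▸ hA)
  · rintro b a hab ⟨z, hz, rfl⟩
    have hab0 : (a 0 : ℤ) ≤ (φ z 0 : ℤ) := by exact_mod_cast Fin.le_def.1 (hab 0)
    have hab1 : (a 1 : ℤ) ≤ (φ z 1 : ℤ) := by exact_mod_cast Fin.le_def.1 (hab 1)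
    have a0 := hb a 0
    have a1 := hb a 1
    have z0 := hb z 0
    have z1 := hb z 1
    by_cases hA : A z
    · rw [φA z hA] at hab0 hab1
      have hrz := hr z hA
      obtain ⟨h1, h2, h3, h4, h5⟩ := hA
      by_cases haD : a ∈ D
      · refine ⟨a, haD, φnA a fun haA => ?_⟩
        obtain ⟨g1, g2, g3, g4, g5⟩ := haA
        obtain ⟨u, hu⟩ := exists_finTwo (q := q) g2 (by omega) g3 g4
        exact g5 ⟨u, low hz (by omega) (by omega), hu⟩
      · by_cases g2 : 0 ≤ (a 1 : ℤ) - c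
        · by_cases g3 : 0 ≤ (a 0 : ℤ) + c
          · obtain ⟨u, hu0, hu1⟩ := exists_finTwo (q := q) g2 (by omega) g3 (by omega)
            have huD : u ∈ D := low hz (by omega) (by omega)
            have huA : A u := by
              refine ⟨?_, by omega, by omega, by omega, ?_⟩
              · by_contra hle
                exact haD (low hz (by omega) (by omega))
              · rintro ⟨v, hv, hv0, hv1⟩
                exact haD (low hv (by omega) (by omega))
            refine ⟨u, huD, ?_⟩
            rw [φA u huA]
            have := hr u huA
            exact finTwo_ext (by omega) (by omega)
          -- Here `c < 0` and `a` reflects off the grid. Reflecting `(z 0, 0)` with `c + 1` gives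
          -- `(-c - 1, z 0 + c + 1)`, which dominates `a`.
          · exfalso
            obtain ⟨v, hv0, hv1⟩ := exists_finTwo (q := q) (i := z 0) (j := 0) (by omega)
              (by omega) le_rfl (by omega)
            have hvD : v ∈ D := low hz (by omega) (by omega)
            obtain ⟨u, hu, hu0, hu1⟩ := hneg (by omega) v hvD (by omega) (by omega) (by omega)
              (by omega)
            exact haD (low hu (by omega) (by omega))
        · exact absurd (low hz (by omega) (by omega)) haD
    · rw [φnA z hA] at hab0 hab1
      have haD : a ∈ D := low hz hab0 hab1
      refine ⟨a, haD, φnA a fun haA => ?_⟩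
      obtain ⟨g1, g2, g3, g4, g5⟩ := haA
      obtain ⟨u, hu0, hu1⟩ := exists_finTwo (q := q) g2 (by omega) g3 g4
      refine g5 ⟨u, ?_, hu0, hu1⟩
      by_cases h1 : (z 1 : ℤ) < z 0 + c
      · by_cases h4 : (z 0 : ℤ) + c < q
        · have : ∃ v ∈ D, (v 0 : ℤ) = z 1 - c ∧ (v 1 : ℤ) = z 0 + c := by
            by_contra hno
            exact hA ⟨h1, by omega, by omega, h4, hno⟩
          obtain ⟨v, hv, hv0, hv1⟩ := this
          exact low hv (by omega) (by omega)
        -- Here `c > 0` and `z` reflects off the grid. Reflecting `(q - c, a 1)` with `c - 1` gives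
        -- `(a 1 - c + 1, q - 1)`, which dominates the reflection of `a`.
        · obtain ⟨v, hv0, hv1⟩ := exists_finTwo (q := q) (i := q - c) (j := a 1) (by omega)
            (by omega) (by omega) (by omega)
          have hvD : v ∈ D := low hz (by omega) (by omega)
          obtain ⟨w, hw, hw0, hw1⟩ := hpos (by omega) v hvD (by omega) (by omega) (by omega)
            (by omega)
          exact low hw (by omega) (by omega)
      · exact low hz (by omega) (by omega)

theorem IsColexMinimal.reflectStable {d : ℕ} {D : Finset (Fin 2 → Fin q)}
    (hD : IsColexMinimal d D) (c : ℤ) : ReflectStable D c := by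
  induction c using Int.induction_on with
  | zero => exact hD.reflectStable_step (fun h => absurd h (by simp)) fun h => absurd h (by simp)
  | succ k ih => exact hD.reflectStable_step (fun h => by omega) fun _ => by simpa using ih
  | pred k ih => exact hD.reflectStable_step (fun _ => by simpa using ih) fun h => by omega

/-- If `y` were heavier, a reflection of `y` would dominate `x`: slide `y` along its antidiagonal to
first coordinate `x 0`, or, if that leaves the grid, to second coordinate `q - 1`. -/
theorem IsColexMinimal.weight_le_of_gap {d : ℕ} {D : Finset (Fin 2 → Fin q)}
    (hD : IsColexMinimal d D) {x y : Fin 2 → Fin q} (hx : x ∉ D) (hy : y ∈ D) (h1 : y 1 < x 1) : ∑ i, (y i : ℕ) ≤ ∑ i, (x i : ℕ) := by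
  rw [Fin.sum_univ_two, Fin.sum_univ_two]
  rw [Fin.lt_def] at h1
  by_contra hlt
  have hy0 := (y 0).2
  have hx1 := (x 1).2
  by_cases hw : (y 0 : ℕ) + y 1 < q + x 0
  · obtain ⟨u, hu, hu0, hu1⟩ := hD.reflectStable ((y 1 : ℤ) - x 0) y hy (by omega) (by omega)
      (by omega) (by omega)
    exact hx (mem_of_le_finTwo hD.1 hu (by omega) (by omega))
  · obtain ⟨u, hu, hu0, hu1⟩ := hD.reflectStable ((q : ℤ) - 1 - y 0) y hy (by omega) (by omega)
      (by omega) (by omega)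
    exact hx (mem_of_le_finTwo hD.1 hu (by omega) (by omega))

end TwoDim

/-! ### Initial segments minimize the low-weight count -/

section LowWeight

variable {n q : ℕ}

/-- From `y` to `x` at most one is lost in coordinate `0`, and at least one is gained in each of the
`n ≥ 1` others. -/
theorem weight_le_of_succ_le {x y : Fin (n + 1) → Fin q} (hn : 0 < n)
    (h0 : (y 0 : ℕ) ≤ x 0 + 1) (h : ∀ i : Fin n, y i.succ < x i.succ) :
    ∑ i, (y i : ℕ) ≤ ∑ i, (x i : ℕ) := by
  rw [Fin.sum_univ_succ, Fin.sum_univ_succ (fun i => (x i : ℕ))]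
  have : ∑ i : Fin n, ((y i.succ : ℕ) + 1) ≤ ∑ i : Fin n, (x i.succ : ℕ) :=
    Finset.sum_le_sum fun i _ => Fin.lt_def.1 (h i)
  rw [Finset.sum_add_distrib] at this
  simp only [Finset.sum_const, Finset.card_univ, Fintype.card_fin, smul_eq_mul, mul_one] at this
  omega

/-- Among the down-sets of a given size, initial segments of the lexicographic order have the
fewest elements of weight at most `d`. -/
theorem card_lowWeight_lexInitial_le (d : ℕ) (D : Finset (Fin n → Fin q))
    (hD : IsLowerSet (D : Set (Fin n → Fin q))) :
    (lowWeight d (lexInitial n q D.card)).card ≤ (lowWeight d D).card := by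
  classical
  induction n generalizing d with
  | zero =>
    rw [← eq_lexInitial_card fun x y hy _ => Subsingleton.elim y x ▸ hy]
  | succ n ih =>
    obtain ⟨D', hmin, hcard, hle⟩ := exists_isColexMinimal d D hD
    refine le_trans (le_of_eq ?_) hle
    rw [← hcard, ← eq_lexInitial_card]
    by_contra hne
    obtain ⟨x, y, hx, hy, hxy, hw⟩ := hmin.exists_gap hne
    refine hw.not_ge ?_
    have hS : ∀ {u v : Fin (n + 1) → Fin q}, v ∈ D' → toLex u < toLex v → ∀ i, u i = v i →
        u ∈ D' := fun hv huv i hi => hmin.mem_of_apply_eq ih hv huv i hi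
    have hdiff : ∀ i, x i ≠ y i := fun i hi => hx (hS hy hxy i hi)
    have h0 : x 0 < y 0 := by
      obtain ⟨j, hj, hlt⟩ := hxy
      rcases eq_or_ne j 0 with rfl | hj0
      · exact hlt
      · exact absurd (hj 0 (Fin.pos_of_ne_zero hj0)) (hdiff 0)
    have hpos : ∀ i : Fin n, y i.succ < x i.succ := by
      intro i
      refine lt_of_le_of_ne (not_lt.1 fun hi => ?_) (hdiff _).symm
      -- This intermediate point shares coordinate `i.succ` with `y` and coordinate `0` with `x`,
      -- and lies lexicographically between them.
      have hz : Function.update x i.succ (y i.succ) ∈ D' := by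
        refine hS hy ⟨0, fun j hj => absurd hj (by simp), ?_⟩ i.succ (by simp)
        change Function.update x i.succ (y i.succ) 0 < y 0
        rwa [Function.update_of_ne (Fin.succ_ne_zero i).symm]
      exact hx (hS hz (Pi.lt_toLex_update_self_iff.2 hi) 0
        (by rw [Function.update_of_ne (Fin.succ_ne_zero i).symm]))
    have hn : 0 < n := by
      refine Nat.pos_of_ne_zero ?_
      rintro rfl
      have hxy' : x ≤ y := fun i => Fin.cases h0.le (fun j => j.elim0) i
      exact hx (hmin.1 hxy' hy)
    rcases lt_or_ge (x 0 + 1 : ℕ) (y 0) with h1 | h1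
    · rcases n with _ | _ | n
      · exact absurd rfl hn.ne
      · exact hmin.weight_le_of_gap hx hy (hpos 0)
      · exfalso
        let c : Fin q := ⟨x 0 + 1, h1.trans (y 0).2⟩
        -- The point `(x 0 + 1, x 1, y 2, …)` lies strictly between `x` and `y`, sharing coordinate
        -- `1` with `x` and coordinate `2` with `y`; this needs three coordinates and `x 0 + 1 < y
        -- 0`.
        let z : Fin (n + 1 + 1 + 1) → Fin q := Function.update (Function.update y 1 (x 1)) 0 c
        have hz : z ∈ D' := by
          refine hS hy ⟨0, fun j hj => absurd hj (by simp), ?_⟩ (0 : Fin (n + 1)).succ.succ ?_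
          · simpa [z, Fin.lt_def, c] using h1
          · have h2 : (0 : Fin (n + 1)).succ.succ ≠ 0 := Fin.succ_ne_zero _
            have h2' : (0 : Fin (n + 1)).succ.succ ≠ 1 := fun h =>
              Fin.succ_ne_zero _ (Fin.succ_injective _ (h.trans Fin.succ_zero_eq_one.symm))
            simp only [z]
            rw [Function.update_of_ne h2, Function.update_of_ne h2']
        refine hx (hS hz ⟨0, fun j hj => absurd hj (by simp), ?_⟩ 1 ?_)
        · simp [z, Fin.lt_def, c]
        · simp [z]
    · exact weight_le_of_succ_le hn h1 hpos

end LowWeight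

/-! ### Standard monomials and the upper bound -/

section StandardMonomials

open MvPolynomial

variable {F : Type*} [Field F] {n q : ℕ}

/-- An exponent vector with entries below `q`, as a finitely supported function. -/
noncomputable def exponent (e : Fin n → Fin q) : Fin n →₀ ℕ :=
  Finsupp.equivFunOnFinite.symm fun i => (e i : ℕ)

@[simp]
theorem exponent_apply (e : Fin n → Fin q) (i : Fin n) : exponent e i = e i := rfl

theorem exponent_injective : Function.Injective (exponent : (Fin n → Fin q) → Fin n →₀ ℕ) := by
  intro e e' h
  funext i
  exact Fin.ext (DFunLike.congr_fun h i)

theorem degree_exponent (e : Fin n → Fin q) : (exponent e).degree = ∑ i, (e i : ℕ) := by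
  rw [Finsupp.degree_eq_sum]
  rfl

/-- The function on `S` defined by the monomial with exponent `e`. -/
def monomialFun (S : Finset (Fin n → F)) (e : Fin n →₀ ℕ) : S → F :=
  fun s => ∏ i, s.1 i ^ e i

theorem monomialFun_add (S : Finset (Fin n → F)) (e e' : Fin n →₀ ℕ) :
    monomialFun S (e + e') = monomialFun S e * monomialFun S e' := by
  funext s
  simp [monomialFun, pow_add, Finset.prod_mul_distrib]

theorem eval_eq_sum_monomialFun (S : Finset (Fin n → F)) (p : MvPolynomial (Fin n) F) :
    (fun s : S => eval s.1 p) = ∑ e ∈ p.support, p.coeff e • monomialFun S e := by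
  funext s
  simp [eval_eq', monomialFun]

/-- A monomial is standard for `S` if on `S` it is not a combination of smaller monomials. -/
def IsStandard (S : Finset (Fin n → F)) (e : Fin n →₀ ℕ) : Prop :=
  monomialFun S e ∉ Submodule.span F
    (monomialFun S '' {e' | MonomialOrder.degLex.toSyn e' < MonomialOrder.degLex.toSyn e})

theorem monomialFun_mem_span_isStandard (S : Finset (Fin n → F)) (e : Fin n →₀ ℕ) :
    monomialFun S e ∈ Submodule.span F (monomialFun S '' {e' | IsStandard S e'}) := by
  induction h : MonomialOrder.degLex.toSyn e using WellFoundedLT.induction generalizing e with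
  | ind x ih =>
    subst h
    by_cases he : IsStandard S e
    · exact Submodule.subset_span ⟨e, he, rfl⟩
    · refine Submodule.span_le.2 ?_ (not_not.1 he)
      rintro _ ⟨e', he', rfl⟩
      exact ih _ he' e' rfl

/-- Multiplying by a monomial preserves the monomial order, so a reduction of `e` yields one of `u +
e`. -/
theorem IsStandard.of_add {S : Finset (Fin n → F)} {e u : Fin n →₀ ℕ}
    (h : IsStandard S (u + e)) : IsStandard S e := by
  intro he
  refine h ?_
  have := Submodule.apply_mem_span_image_of_mem_span (LinearMap.mulLeft F (monomialFun S u)) he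
  rw [LinearMap.mulLeft_apply, ← monomialFun_add] at this
  refine Submodule.span_mono ?_ this
  rintro _ ⟨_, ⟨e', he', rfl⟩, rfl⟩
  refine ⟨u + e', ?_, by rw [LinearMap.mulLeft_apply, monomialFun_add]⟩
  simpa using he'

theorem IsStandard.mono {S : Finset (Fin n → F)} {e e' : Fin n →₀ ℕ}
    (h : IsStandard S e') (hle : e ≤ e') : IsStandard S e := by
  obtain ⟨u, rfl⟩ := exists_add_of_le hle
  rw [add_comm] at h
  exact h.of_add

/-- With `q` the size of the field, `X i ^ q` and the smaller monomial `X i` are the same function.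
-/
theorem IsStandard.apply_lt [Fintype F] {S : Finset (Fin n → F)} {e : Fin n →₀ ℕ}
    (h : IsStandard S e) (i : Fin n) : e i < Fintype.card F := by
  by_contra hi
  have hle : Finsupp.single i (Fintype.card F) ≤ e := by
    rw [Finsupp.single_le_iff]
    exact not_lt.1 hi
  refine h.mono hle (Submodule.subset_span ⟨Finsupp.single i 1, ?_, ?_⟩)
  · rw [Set.mem_ofPred_eq, MonomialOrder.degLex_lt_iff, Finsupp.DegLex.lt_iff]
    left
    simpa using Fintype.one_lt_card (α := F)
  · funext s
    simp only [monomialFun]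
    refine Finset.prod_congr rfl fun j _ => ?_
    rcases eq_or_ne j i with rfl | hji
    · simp [FiniteField.pow_card]
    · simp [Finsupp.single_eq_of_ne hji]

/-- A polynomial that vanishes on `S` and involves only monomials standard for `S` is zero. -/
theorem eq_zero_of_isStandard {S : Finset (Fin n → F)} {p : MvPolynomial (Fin n) F}
    (hp : ∀ e ∈ p.support, IsStandard S e) (h : ∀ s ∈ S, eval s p = 0) : p = 0 := by
  classical
  by_contra hp0
  have hmem := MonomialOrder.degLex.degree_mem_support hp0
  refine hp _ hmem ?_
  set e := MonomialOrder.degLex.degree p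
  have hsum : (0 : S → F) = ∑ e ∈ p.support, p.coeff e • monomialFun S e := by
    rw [← eval_eq_sum_monomialFun]
    funext s
    exact (h s.1 s.2).symm
  rw [← Finset.add_sum_erase _ _ hmem] at hsum
  have hmul : p.coeff e • monomialFun S e ∈ Submodule.span F (monomialFun S ''
      {e' | MonomialOrder.degLex.toSyn e' < MonomialOrder.degLex.toSyn e}) := by
    rw [eq_neg_of_add_eq_zero_left hsum.symm]
    refine Submodule.neg_mem _ (Submodule.sum_mem _ fun e' he' => Submodule.smul_mem _ _
      (Submodule.subset_span ⟨e', ?_, rfl⟩))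
    obtain ⟨hne, he'⟩ := Finset.mem_erase.1 he'
    exact lt_of_le_of_ne (MonomialOrder.degLex.le_degree he') fun hh =>
      hne (MonomialOrder.degLex.toSyn.injective hh)
  exact (Submodule.smul_mem_iff _ (mem_support_iff.1 hmem)).1 hmul

/-- The hypothesis makes the monomials in `A` linearly independent in the space of functions on `T`,
whose dimension is `|T|`. -/
theorem card_le_of_forall_eq_zero {T : Finset (Fin n → F)} {A : Finset (Fin n → Fin q)}
    (h : ∀ p : MvPolynomial (Fin n) F, (∀ e ∈ p.support, ∃ x ∈ A, exponent x = e) →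
      (∀ t ∈ T, eval t p = 0) → p = 0) : A.card ≤ T.card := by
  classical
  have hli : LinearIndependent F fun x : A => monomialFun T (exponent x.1) := by
    rw [Fintype.linearIndependent_iff]
    intro g hg
    have hcoeff : ∀ e, coeff e (∑ x : A, monomial (exponent x.1) (g x)) =
        ∑ x : A, if exponent x.1 = e then g x else 0 := by
      intro e
      simp [coeff_sum, coeff_monomial]
    have h0 := h (∑ x : A, monomial (exponent x.1) (g x)) ?_ ?_
    · intro x
      have hx := hcoeff (exponent x.1)
      rw [h0, coeff_zero, Finset.sum_eq_single x, if_pos rfl] at hx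
      · exact hx.symm
      · intro y _ hy
        exact if_neg fun hh => hy (Subtype.ext (exponent_injective hh))
      · simp
    · intro e he
      rw [mem_support_iff, hcoeff] at he
      obtain ⟨x, -, hx⟩ := Finset.exists_ne_zero_of_sum_ne_zero he
      exact ⟨x.1, x.2, by_contra fun hh => hx (if_neg hh)⟩
    · intro t ht
      have := congrFun hg ⟨t, ht⟩
      simp only [Finset.sum_apply, Pi.smul_apply, smul_eq_mul, monomialFun, Pi.zero_apply] at this
      rw [map_sum, ← this]
      refine Finset.sum_congr rfl fun x _ => ?_
      rw [eval_monomial, Finsupp.prod_fintype _ _ (by simp)]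
  simpa using hli.fintype_card_le_finrank

/-- Over a finite field every function, here an extension by zero, is a polynomial, and each
monomial reduces to standard ones. -/
theorem span_monomialFun_isStandard [Finite F] (S : Finset (Fin n → F)) :
    Submodule.span F (monomialFun S '' {e | IsStandard S e}) = ⊤ := by
  classical
  have := Fintype.ofFinite F
  refine top_unique fun g _ => ?_
  obtain ⟨p, -, hp⟩ : (fun x => if hx : x ∈ S then g ⟨x, hx⟩ else 0) ∈
      (restrictDegree (Fin n) F (Fintype.card F - 1)).map (evalₗ F (Fin n)) := by
    rw [map_restrict_dom_evalₗ]
    trivial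
  have hg : g = fun s : S => eval s.1 p := by
    funext s
    have := congrFun hp s.1
    rw [evalₗ_apply] at this
    simp [this]
  rw [hg, eval_eq_sum_monomialFun]
  exact Submodule.sum_mem _ fun e _ => Submodule.smul_mem _ _ (monomialFun_mem_span_isStandard S e)

/-- The exponents of the standard monomials of `S` form a down-set of size `|S|`. -/
theorem exists_standard [Fintype F] (hq : Fintype.card F = q) (S : Finset (Fin n → F)) :
    ∃ D : Finset (Fin n → Fin q), IsLowerSet (D : Set (Fin n → Fin q)) ∧ D.card = S.card ∧
      ∀ x ∈ D, IsStandard S (exponent x) := by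
  classical
  refine ⟨Finset.univ.filter fun x => IsStandard S (exponent x), ?_, le_antisymm ?_ ?_, by simp⟩
  · intro x y hle hx
    simp only [Finset.coe_filter, Finset.mem_univ, true_and, Set.mem_ofPred_eq] at hx ⊢
    exact hx.mono fun i => hle i
  · refine card_le_of_forall_eq_zero fun p hp => eq_zero_of_isStandard fun e he => ?_
    obtain ⟨x, hx, rfl⟩ := hp e he
    simpa using hx
  · set D := Finset.univ.filter fun x : Fin n → Fin q => IsStandard S (exponent x)
    have hsub : monomialFun S '' {e | IsStandard S e} ⊆
        (D.image fun x => monomialFun S (exponent x) : Finset (S → F)) := by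
      rintro _ ⟨e, he, rfl⟩
      have hx : exponent (fun i => (⟨e i, hq ▸ IsStandard.apply_lt he i⟩ : Fin q)) = e := by
        ext i
        rfl
      rw [Finset.mem_coe, Finset.mem_image]
      refine ⟨fun i => ⟨e i, hq ▸ IsStandard.apply_lt he i⟩, ?_, by rw [hx]⟩
      simp only [D, Finset.mem_filter, Finset.mem_univ, true_and, hx]
      exact he
    have htop : Submodule.span F
        ((D.image fun x => monomialFun S (exponent x) : Finset (S → F)) : Set (S → F)) = ⊤ :=
      top_unique ((span_monomialFun_isStandard S).ge.trans (Submodule.span_mono hsub))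
    have hcard := finrank_span_finset_le_card (R := F)
      (D.image fun x => monomialFun S (exponent x))
    rw [Set.finrank, htop, finrank_top, Module.finrank_fintype_fun_eq_card,
      Fintype.card_coe] at hcard
    exact hcard.trans Finset.card_image_le

/-- The Hilbert function bound: a set whose degree-`d` closure has `k` points has at least as many
points as the first `k` vectors have elements of weight at most `d`. -/
theorem card_lowWeight_lexInitial_ncard_le [Fintype F] (hq : Fintype.card F = q) (d : ℕ)
    (T : Finset (Fin n → F)) :
    (lowWeight d (lexInitial n q (degreeClosure d (T : Set (Fin n → F))).ncard)).card
      ≤ T.card := by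
  classical
  have hfin := Set.toFinite (degreeClosure d (T : Set (Fin n → F)))
  obtain ⟨D, hD, hcard, hstd⟩ := exists_standard hq hfin.toFinset
  rw [Set.ncard_eq_toFinset_card _ hfin, ← hcard]
  refine (card_lowWeight_lexInitial_le d D hD).trans (card_le_of_forall_eq_zero (F := F) ?_)
  intro p hp hT
  have hdeg : p.totalDegree ≤ d := by
    refine Finset.sup_le fun e he => ?_
    obtain ⟨x, hx, rfl⟩ := hp e he
    exact (degree_exponent x).le.trans (mem_lowWeight.1 hx).2
  refine eq_zero_of_isStandard (S := hfin.toFinset) (fun e he => ?_) fun s hs => ?_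
  · obtain ⟨x, hx, rfl⟩ := hp e he
    exact hstd x (lowWeight_subset _ _ hx)
  · exact (hfin.mem_toFinset.1 hs) p hdeg hT

end StandardMonomials

/-! ### Grid points of a down-set and the lower bound -/

section Grid

open MvPolynomial

variable {F : Type*} [Field F] {n q : ℕ}

/-- The product of the linear forms `X i - a i j` over all `i` and `j < x i`. -/
noncomputable def newtonPoly (a : Fin n → (Fin q ≃ F)) (x : Fin n → Fin q) :
    MvPolynomial (Fin n) F :=
  ∏ i, ∏ j ∈ Finset.Iio (x i), (X i - C (a i j))

theorem eval_newtonPoly (a : Fin n → (Fin q ≃ F)) (x y : Fin n → Fin q) :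
    eval (gridPoint a y) (newtonPoly a x) = ∏ i, ∏ j ∈ Finset.Iio (x i), (a i (y i) - a i j) := by
  simp [newtonPoly, gridPoint]

theorem eval_newtonPoly_eq_zero (a : Fin n → (Fin q ≃ F)) {x y : Fin n → Fin q} {i : Fin n}
    (h : y i < x i) : eval (gridPoint a y) (newtonPoly a x) = 0 := by
  rw [eval_newtonPoly]
  exact Finset.prod_eq_zero (Finset.mem_univ i)
    (Finset.prod_eq_zero (Finset.mem_Iio.2 h) (sub_self _))

theorem coeff_newtonPoly (a : Fin n → (Fin q ≃ F)) (x : Fin n → Fin q) :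
    coeff (exponent x) (newtonPoly a x) = 1 := by
  have hmonic : ∀ i, MonomialOrder.degLex.Monic (∏ j ∈ Finset.Iio (x i), (X i - C (a i j))) :=
    fun i => MonomialOrder.Monic.prod fun j _ => MonomialOrder.degLex.monic_X_sub_C i _
  have hdeg : ∀ i, MonomialOrder.degLex.degree (∏ j ∈ Finset.Iio (x i), (X i - C (a i j))) =
      Finsupp.single i (x i : ℕ) := by
    intro i
    rw [MonomialOrder.degree_prod_of_regular]
    · simp [MonomialOrder.degree_X_sub_C]
    · intro j _
      rw [(MonomialOrder.degLex.monic_X_sub_C i (a i j)).leadingCoeff_eq_one]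
      exact isRegular_one
  have hsum : ∑ i, MonomialOrder.degLex.degree (∏ j ∈ Finset.Iio (x i), (X i - C (a i j))) =
      exponent x := by
    simp only [hdeg]
    exact (exponent x).univ_sum_single
  rw [newtonPoly, ← hsum, MonomialOrder.coeff_prod_sum_degree]
  exact Finset.prod_eq_one fun i _ => (hmonic i).leadingCoeff_eq_one

theorem totalDegree_newtonPoly_le (a : Fin n → (Fin q ≃ F)) (x : Fin n → Fin q) :
    (newtonPoly a x).totalDegree ≤ ∑ i, (x i : ℕ) := by
  refine (totalDegree_finsetProd _ _).trans (Finset.sum_le_sum fun i _ => ?_)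
  refine (totalDegree_finsetProd _ _).trans ?_
  refine (Finset.sum_le_card_nsmul _ _ 1 fun j _ => ?_).trans (by simp)
  exact (totalDegree_sub_C_le _ _).trans (totalDegree_X i).le

/-- If a polynomial of degree less than `∑ i, x i` vanishes on the grid points of the box below
`x` other than `x`, then it vanishes at the grid point of `x`. -/
theorem eval_gridPoint_eq_zero_of_box (a : Fin n → (Fin q ≃ F)) {x : Fin n → Fin q}
    {f : MvPolynomial (Fin n) F} (hf : f.totalDegree < ∑ i, (x i : ℕ))
    (h : ∀ y < x, eval (gridPoint a y) f = 0) : eval (gridPoint a x) f = 0 := by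
  classical
  by_contra hne
  set g := newtonPoly a x with hg
  -- `P` vanishes on the whole box: at `x` the terms cancel, and elsewhere both `f` and `g` vanish.
  -- Yet its coefficient at `exponent x`, of top degree, comes from `g` alone and is nonzero,
  -- contradicting the Nullstellensatz.
  set P := C (eval (gridPoint a x) g) * f - C (eval (gridPoint a x) f) * g with hP
  have hfcoeff : coeff (exponent x) f = 0 := by
    refine coeff_eq_zero_of_totalDegree_lt ?_
    rwa [← Finsupp.degree_apply, degree_exponent]
  have hcoeff : coeff (exponent x) P ≠ 0 := by
    rw [hP, coeff_sub, coeff_C_mul, coeff_C_mul, hfcoeff, coeff_newtonPoly]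
    simpa using hne
  have hdeg : P.totalDegree = (exponent x).degree := by
    refine le_antisymm ?_ (le_totalDegree (mem_support_iff.2 hcoeff))
    rw [degree_exponent]
    refine (totalDegree_sub _ _).trans (max_le ?_ ?_)
    · refine (totalDegree_mul _ _).trans ?_
      rw [totalDegree_C]
      omega
    · refine (totalDegree_mul _ _).trans ?_
      rw [totalDegree_C, zero_add]
      exact totalDegree_newtonPoly_le a x
  obtain ⟨s, hs, hs0⟩ := combinatorial_nullstellensatz_exists_eval_nonzero P (exponent x) hcoeff
    hdeg (fun i => (Finset.Iic (x i)).image (a i)) (fun i => by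
      rw [Finset.card_image_of_injective _ (a i).injective]
      simp)
  have hs' : ∀ i, ∃ j, j ≤ x i ∧ a i j = s i := fun i => by simpa using hs i
  choose y hy hys using hs'
  obtain rfl : gridPoint a y = s := funext hys
  apply hs0
  rw [hP, map_sub, map_mul, map_mul, eval_C, eval_C]
  rcases eq_or_lt_of_le (show y ≤ x from hy) with rfl | hlt
  · ring
  · obtain ⟨i, hi⟩ := (Pi.lt_def.1 hlt).2
    rw [h y hlt, eval_newtonPoly_eq_zero a hi]
    simp

/-- On the grid points of a down-set `D`, a polynomial of degree at most `d` is determined by its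
values at the points of weight at most `d`. -/
theorem eval_gridPoint_eq_zero (a : Fin n → (Fin q ≃ F)) {d : ℕ} {D : Finset (Fin n → Fin q)}
    (hD : IsLowerSet (D : Set (Fin n → Fin q))) {f : MvPolynomial (Fin n) F}
    (hf : f.totalDegree ≤ d) (h : ∀ x ∈ lowWeight d D, eval (gridPoint a x) f = 0) :
    ∀ x ∈ D, eval (gridPoint a x) f = 0 := by
  intro x
  induction x using WellFoundedLT.induction with
  | ind x ih =>
    intro hx
    rcases le_or_gt (∑ i, (x i : ℕ)) d with hw | hw
    · exact h x (mem_lowWeight.2 ⟨hx, hw⟩)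
    · exact eval_gridPoint_eq_zero_of_box a (hf.trans_lt hw) fun y hy => ih y hy (hD hy.le hx)

theorem card_le_ncard_degreeClosure [Finite F] (a : Fin n → (Fin q ≃ F)) {d : ℕ}
    {D : Finset (Fin n → Fin q)} (hD : IsLowerSet (D : Set (Fin n → Fin q)))
    {T : Finset (Fin n → F)} (hT : (lowWeight d D).map (gridPoint a).toEmbedding ⊆ T) :
    D.card ≤ (degreeClosure d (T : Set (Fin n → F))).ncard := by
  rw [← Finset.card_map (gridPoint a).toEmbedding, ← Set.ncard_coe_finset]
  refine Set.ncard_le_ncard ?_ (Set.toFinite _)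
  intro u hu f hf hfT
  obtain ⟨x, hx, rfl⟩ := Finset.mem_map.1 (Finset.mem_coe.1 hu)
  exact eval_gridPoint_eq_zero a hD hf
    (fun y hy => hfT _ (hT (Finset.mem_map_of_mem _ hy))) x hx

end Grid

/-! ### The main theorem -/

theorem mainTheorem4 {F : Type*} [Field F] [Fintype F] (q : ℕ) (hq : Fintype.card F = q)
    (n d m : ℕ) :
    ∃ K : ℕ,
      IsGreatest {k : ℕ | k ≤ q ^ n ∧ (lowWeight d (lexInitial n q k)).card ≤ m} K ∧
      (∀ T : Finset (Fin n → F), T.card = m →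
        (degreeClosure d (T : Set (Fin n → F))).ncard ≤ K) ∧
      (m ≤ numMonomials n d (q - 1) →
        IsGreatest {k : ℕ | k ≤ q ^ n ∧ (lowWeight d (lexInitial n q k)).card = m} K) ∧
      (numMonomials n d (q - 1) < m → K = q ^ n) ∧
      (m ≤ q ^ n →
        (∃ T : Finset (Fin n → F), T.card = m ∧
          (degreeClosure d (T : Set (Fin n → F))).ncard = K) ∧
        ∀ (a : Fin n → (Fin q ≃ F)) (T₀ T : Finset (Fin n → F)),
          T₀ = (lowWeight d (lexInitial n q K)).map (gridPoint a).toEmbedding →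
          (m ≤ T₀.card ∧ T = T₀) ∨ (T₀.card < m ∧ T₀ ⊆ T ∧ T.card = m) →
          T.card = m ∧ (degreeClosure d (T : Set (Fin n → F))).ncard = K) := by
  classical
  have hqpos : 0 < q := hq ▸ Fintype.card_pos
  have hne : {k : ℕ | k ≤ q ^ n ∧ (lowWeight d (lexInitial n q k)).card ≤ m}.Nonempty :=
    ⟨0, Nat.zero_le _, by
      refine (Finset.card_le_card (lowWeight_subset _ _)).trans ?_
      rw [card_lexInitial (Nat.zero_le _)]
      exact Nat.zero_le _⟩
  have hbdd : BddAbove {k : ℕ | k ≤ q ^ n ∧ (lowWeight d (lexInitial n q k)).card ≤ m} :=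
    ⟨q ^ n, fun k hk => hk.1⟩
  obtain ⟨K, hK⟩ : ∃ K, IsGreatest
      {k : ℕ | k ≤ q ^ n ∧ (lowWeight d (lexInitial n q k)).card ≤ m} K :=
    ⟨_, Nat.sSup_mem hne hbdd, fun k hk => le_csSup hbdd hk⟩
  have hupper : ∀ T : Finset (Fin n → F), T.card = m →
      (degreeClosure d (T : Set (Fin n → F))).ncard ≤ K := by
    intro T hT
    refine hK.2 ⟨?_, hT ▸ card_lowWeight_lexInitial_ncard_le hq d T⟩
    have := Set.ncard_le_ncard (Set.subset_univ (degreeClosure d (T : Set (Fin n → F))))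
      Set.finite_univ
    simpa [Set.ncard_univ, hq] using this
  -- If the count at `K` were below `m`, one more vector could be admitted.
  have htop : K < q ^ n → (lowWeight d (lexInitial n q K)).card = m := by
    intro hlt
    refine le_antisymm hK.1.2 ?_
    by_contra hm
    have := card_lowWeight_lexInitial_succ_le (n := n) (q := q) d K
    have := hK.2 (show K + 1 ∈ _ from ⟨hlt, by omega⟩)
    omega
  have hfull : K = q ^ n → (lowWeight d (lexInitial n q K)).card = numMonomials n d (q - 1) := by
    rintro rfl
    rw [lexInitial_pow, card_lowWeight_univ n d hqpos]
  have hexplicit : ∀ (a : Fin n → (Fin q ≃ F)) (T₀ T : Finset (Fin n → F)),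
      T₀ = (lowWeight d (lexInitial n q K)).map (gridPoint a).toEmbedding →
      (m ≤ T₀.card ∧ T = T₀) ∨ (T₀.card < m ∧ T₀ ⊆ T ∧ T.card = m) →
      T.card = m ∧ (degreeClosure d (T : Set (Fin n → F))).ncard = K := by
    intro a T₀ T hT₀ hT
    -- So the alternative `m ≤ T₀.card` only occurs with equality.
    have hcard : T₀.card ≤ m := by
      rw [hT₀, Finset.card_map]
      exact hK.1.2
    have hT' : T₀ ⊆ T ∧ T.card = m := by
      rcases hT with ⟨h1, rfl⟩ | ⟨-, h⟩
      · exact ⟨Finset.Subset.refl _, le_antisymm hcard h1⟩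
      · exact h
    refine ⟨hT'.2, le_antisymm (hupper T hT'.2) ?_⟩
    have := card_le_ncard_degreeClosure a (isLowerSet_lexInitial K) (hT₀ ▸ hT'.1)
    rwa [card_lexInitial hK.1.1] at this
  refine ⟨K, hK, hupper, fun hm => ⟨⟨hK.1.1, ?_⟩, fun k hk => hK.2 ⟨hk.1, hk.2.le⟩⟩, fun hm => ?_,
    fun hm => ⟨?_, hexplicit⟩⟩
  · rcases hK.1.1.lt_or_eq with h | h
    · exact htop h
    · exact le_antisymm hK.1.2 (hm.trans (hfull h).ge)
  · by_contra h
    have h1 := htop (lt_of_le_of_ne hK.1.1 h)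
    have h2 := Finset.card_le_card
      (lowWeight_mono d (Finset.subset_univ (lexInitial n q K)))
    rw [card_lowWeight_univ n d hqpos] at h2
    omega
  · let a : Fin n → (Fin q ≃ F) := fun _ => (Fintype.equivFinOfCardEq hq).symm
    have hcard : ((lowWeight d (lexInitial n q K)).map (gridPoint a).toEmbedding).card ≤ m := by
      rw [Finset.card_map]
      exact hK.1.2
    obtain ⟨T, hsub, hT⟩ := Finset.exists_superset_card_eq hcard (by simpa [hq] using hm)
    refine ⟨T, hexplicit a _ T rfl ?_⟩
    rcases hcard.lt_or_eq with h | h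
    · exact Or.inr ⟨h, hsub, hT⟩
    · exact Or.inl ⟨h.ge, (Finset.eq_of_subset_of_card_le hsub (by rw [hT, h])).symm⟩
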